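/- Proposition (deep linear network, Schatten-$2/L$ bound). Let $L\ge 1$ and $q\ge r>0$ be integers and let $A_1,\dots,A_L$ be real matrices with $A_l\in\mathbb{R}^{d_{l-1}\times d_l}$, where $d_0=d_L=q$ and $d_l=r$ for $0<l<L$ (so, for $L\ge 2$, $A_1$ is $q\times r$, $A_2,\dots,A_{L-1}$ are $r\times r$, and $A_L$ is $r\times q$). For a real matrix $W$ with singular values $s_i(W)$, write $\|W\|_*=\sum_i s_i(W)$ for the nuclear norm, $\|W\|_F$ for the Frobenius norm and $\|W\|_p=\big(\sum_{i:\,s_i(W)\neq 0} s_i(W)^p\big)^{1/p}$ for the Schatten $p$-(quasi-)norm, $p>0$. Let $\varepsilon>0$, and assume that the chain is $\varepsilon$-balanced in nuclear norm, i.e. for all $1\le l\le L-1$, $$\left\|A_l^\top A_l - A_{l+1}A_{l+1}^\top\right\|_*\le\varepsilon ,$$ and that $$\varepsilon\le \frac{1}{L^{4}}\,\min_{1\le l\le L}\|A_l\|_*^{L}.$$ Then for every $k\in\{1,\dots,L\}$, $$\left|\ \Big\|\prod_{l=1}^L A_l\Big\|_{2/L}^{2/L}-\|A_k\|_F^2\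 \right|\le r\,\|A_k\|_*^{L-1}\,e^{2/L}\,L^{4/L}\,\varepsilon^{1/L},$$ and $$\left|\ \Big\|\prod_{l=1}^L A_l\Big\|_{2/L}^{2/L}-\frac1L\sum_{l=1}^L\|A_l\|_F^2\ \right|\le \frac rL\Big(\sum_{l=1}^L\|A_l\|_*^{L-1}\Big)e^{2/L}L^{4/L}\varepsilon^{1/L},$$ where $\prod_{l=1}^L A_l=A_1A_2\cdots A_L$. -/

import Mathlib

open scoped Matrix Matrix.Norms.Frobenius

/-- The (zero-indexed, decreasing, finitely supported) sequence of singular values of a real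
matrix, i.e. those of the linear map it defines between Euclidean spaces. -/
noncomputable def matrixSingularValues {m n : ℕ} (W : Matrix (Fin m) (Fin n) ℝ) : ℕ →₀ ℝ :=
  (Matrix.toEuclideanLin W).singularValues

/-- The nuclear norm `‖W‖_* = Tr √(W Wᵀ)`: the sum of the singular values. -/
noncomputable def nuclearNorm {m n : ℕ} (W : Matrix (Fin m) (Fin n) ℝ) : ℝ :=
  (matrixSingularValues W).sum fun _ s => s

/-- The Schatten `p`-(quasi-)norm `‖W‖_p = (∑ sᵢ ^ p) ^ (1 / p)`, for real `p > 0`; the sum runs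
over the nonzero singular values, the zero ones contributing nothing. -/
noncomputable def schattenNorm {m n : ℕ} (p : ℝ) (W : Matrix (Fin m) (Fin n) ℝ) : ℝ :=
  ((matrixSingularValues W).sum fun _ s => s ^ p) ^ (1 / p)

/-- The dimensions `d₀, …, d_L` of a chain of `L` matrices: the two outer dimensions are `q`, the
inner ones are `r`. -/
def chainDim (q r L : ℕ) (i : ℕ) : ℕ := if i = 0 ∨ i = L then q else r

/-- A chain of `L` real matrices; the one with (zero-based) index `l` is of size
`d l × d (l + 1)`. -/
abbrev MatrixChain (d : ℕ → ℕ) (L : ℕ) : Type :=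
  (l : Fin L) → Matrix (Fin (d l)) (Fin (d (l + 1))) ℝ

/-- The product, from left to right, of the first `m` matrices of a chain. -/
def MatrixChain.partialProd {d : ℕ → ℕ} {L : ℕ} (A : MatrixChain d L) :
    (m : ℕ) → m ≤ L → Matrix (Fin (d 0)) (Fin (d m)) ℝ
  | 0, _ => 1
  | m + 1, h => A.partialProd m (Nat.le_of_succ_le h) * A ⟨m, h⟩

/-- The product, from left to right, of all matrices of a chain. -/
def MatrixChain.prod {d : ℕ → ℕ} {L : ℕ} (A : MatrixChain d L) :
    Matrix (Fin (d 0)) (Fin (d L)) ℝ :=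
  A.partialProd L le_rfl

/-- A chain is `ε`-balanced (in nuclear norm) if
`‖A_lᵀ A_l - A_{l+1} A_{l+1}ᵀ‖_* ≤ ε` for all consecutive `A_l`, `A_{l+1}`. -/
def MatrixChain.IsBalanced {d : ℕ → ℕ} {L : ℕ} (A : MatrixChain d L) (ε : ℝ) : Prop :=
  ∀ (l : ℕ) (h : l + 1 < L),
    nuclearNorm ((A ⟨l, Nat.lt_of_succ_lt h⟩)ᵀ * A ⟨l, Nat.lt_of_succ_lt h⟩
      - A ⟨l + 1, h⟩ * (A ⟨l + 1, h⟩)ᵀ) ≤ ε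

/-!
The estimate follows from a stronger one that is linear in `ε`, with a constant depending only on
`r` and `L`. Write `N = A₁ ⋯ A_L`, take a vector `y_L`, put `y_{l-1} = A_l y_l`, and consider the
growth ratios `ρ_l = ‖A_l y_l‖² / ‖y_l‖²`, whose product is `‖N y_L‖² / ‖y_L‖²`. By Cauchy–Schwarz
`‖A_lᵀ A_l y_l‖² ≥ ρ_l ‖A_l y_l‖²`, and by balancedness `A_{l-1}ᵀ A_{l-1}` differs from `A_l A_lᵀ`
by at most `ε` as a quadratic form, so that `ρ_{l-1} ≥ ρ_l - ε`
(`sub_mul_norm_sq_le_of_balanced`, `norm_sq_le_add_mul_of_balanced`). Hence the product of the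
ratios is at least `(ρ_L - (L-1) ε)^L` when `ρ_L ≥ (L-1) ε`, and at most `(ρ_1 + (L-1) ε)^L`. The
min-max principle (`LinearMap.le_singularValues_sq`, `LinearMap.singularValues_sq_le`), applied to
the singular subspaces of `A_L` and to the preimage of those of `A₁`, turns this into
`s_i(A_L)² - (L-1) ε ≤ s_i(N)^(2/L) ≤ s_i(A₁)² + (L-1) ε`.

Summing over the at most `r` relevant indices, and comparing the Frobenius norms of the factors by
`|tr X| ≤ ‖X‖_*`, gives
`|‖N‖_{2/L}^{2/L} - ‖A_k‖_F²| ≤ (r + 1) (L - 1) ε`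
(`MatrixChain.IsBalanced.abs_schattenNorm_prod_sub_le`). Finally the smallness condition bounds
`L⁴ ε` by `‖A_k‖_*^{L-1} L^{4/L} ε^{1/L}` (`mul_pow_four_le_of_le_one_div_mul_pow`), which absorbs the
constant. When `L = 1` both sides of the linear bound vanish, so the rank of the single factor,
which may exceed `r`, does not matter.
-/

/-! ### Singular values and subspaces -/

namespace LinearMap

open Module InnerProductSpace

section SingularValues

variable {E F : Type*} [NormedAddCommGroup E] [InnerProductSpace ℝ E] [FiniteDimensional ℝ E]
  [NormedAddCommGroup F] [InnerProductSpace ℝ F] [FiniteDimensional ℝ F]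

/-- An orthonormal basis of right singular vectors, ordered by decreasing singular value. -/
noncomputable def rightSingularBasis (T : E →ₗ[ℝ] F) : OrthonormalBasis (Fin (finrank ℝ E)) ℝ E :=
  T.isSymmetric_adjoint_comp_self.eigenvectorBasis rfl

theorem norm_sq_apply_eq_sum_singularValues (T : E →ₗ[ℝ] F) (x : E) :
    ‖T x‖ ^ 2 = ∑ i : Fin (finrank ℝ E),
      T.singularValues i ^ 2 * ⟪T.rightSingularBasis i, x⟫_ℝ ^ 2 := by
  have h1 : ‖T x‖ ^ 2 = ⟪x, (adjoint T ∘ₗ T) x⟫_ℝ := by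
    rw [comp_apply, adjoint_inner_right, real_inner_self_eq_norm_sq]
  rw [h1, ← T.rightSingularBasis.sum_inner_mul_inner]
  refine Finset.sum_congr rfl fun i _ => ?_
  have h2 := T.isSymmetric_adjoint_comp_self.eigenvectorBasis_apply_self_apply rfl x i
  rw [OrthonormalBasis.repr_apply_apply, OrthonormalBasis.repr_apply_apply] at h2
  rw [T.sq_singularValues_fin rfl, rightSingularBasis, h2, real_inner_comm]
  simp only [RCLike.ofReal_real_eq_id, id_eq]
  ring

theorem norm_apply_rightSingularBasis (T : E →ₗ[ℝ] F) (i : Fin (finrank ℝ E)) :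
    ‖T (T.rightSingularBasis i)‖ = T.singularValues i := by
  rw [← sq_eq_sq₀ (norm_nonneg _) (T.singularValues_nonneg i),
    norm_sq_apply_eq_sum_singularValues, Finset.sum_eq_single i]
  · simp
  · intro j _ hj
    simp [T.rightSingularBasis.inner_eq_ite, hj]
  · simp

theorem norm_apply_le_singularValues_zero_mul (T : E →ₗ[ℝ] F) (x : E) :
    ‖T x‖ ≤ T.singularValues 0 * ‖x‖ := by
  rw [← sq_le_sq₀ (norm_nonneg _) (mul_nonneg (T.singularValues_nonneg 0) (norm_nonneg _)),
    norm_sq_apply_eq_sum_singularValues, mul_pow,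
    ← T.rightSingularBasis.sum_sq_inner_right, Finset.mul_sum]
  refine Finset.sum_le_sum fun i _ => mul_le_mul_of_nonneg_right ?_ (sq_nonneg _)
  exact pow_le_pow_left₀ (T.singularValues_nonneg i) (T.singularValues_antitone (Nat.zero_le _)) 2

/-- The orthogonal complement of finitely many vectors has codimension at most
their number. -/
theorem finrank_le_finrank_orthogonal_span_add_card {ι : Type*} [DecidableEq E]
    (b : ι → E) (s : Finset ι) :
    finrank ℝ E ≤ finrank ℝ (Submodule.span ℝ (s.image b : Set E))ᗮ + s.card := by
  have h1 := (Submodule.span ℝ (s.image b : Set E)).finrank_add_finrank_orthogonal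
  have h2 := finrank_span_finset_le_card (R := ℝ) (s.image b)
  have h3 : (s.image b).card ≤ s.card := Finset.card_image_le
  simp only [Set.finrank] at h2
  lia

theorem exists_submodule_singularValues_sq_mul_le (T : E →ₗ[ℝ] F) {i : ℕ} (hi : i < finrank ℝ E) :
    ∃ U : Submodule ℝ E, i + 1 ≤ finrank ℝ U ∧
      ∀ x ∈ U, T.singularValues i ^ 2 * ‖x‖ ^ 2 ≤ ‖T x‖ ^ 2 := by
  classical
  refine ⟨(Submodule.span ℝ
    ((Finset.Ioi (⟨i, hi⟩ : Fin _)).image T.rightSingularBasis : Set E))ᗮ, ?_, fun x hx => ?_⟩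
  · have := finrank_le_finrank_orthogonal_span_add_card T.rightSingularBasis
      (Finset.Ioi (⟨i, hi⟩ : Fin _))
    rw [Fin.card_Ioi] at this
    simp only at this
    lia
  · rw [norm_sq_apply_eq_sum_singularValues, ← T.rightSingularBasis.sum_sq_inner_right,
      Finset.mul_sum]
    refine Finset.sum_le_sum fun j _ => ?_
    rcases le_or_gt j ⟨i, hi⟩ with hj | hj
    · exact mul_le_mul_of_nonneg_right (pow_le_pow_left₀ (T.singularValues_nonneg i)
        (T.singularValues_antitone hj) 2) (sq_nonneg _)
    · have : ⟪T.rightSingularBasis j, x⟫_ℝ = 0 :=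
        (Submodule.mem_orthogonal _ _).1 hx _ (Submodule.subset_span
          (Finset.mem_coe.2 (Finset.mem_image_of_mem _ (Finset.mem_Ioi.2 hj))))
      simp [this]

theorem exists_submodule_le_singularValues_sq_mul (T : E →ₗ[ℝ] F) (i : ℕ) :
    ∃ V : Submodule ℝ E, finrank ℝ E ≤ finrank ℝ V + i ∧
      ∀ x ∈ V, ‖T x‖ ^ 2 ≤ T.singularValues i ^ 2 * ‖x‖ ^ 2 := by
  classical
  rcases le_or_gt (finrank ℝ E) i with hi | hi
  · refine ⟨⊥, by lia, fun x hx => ?_⟩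
    simp [(Submodule.mem_bot ℝ).1 hx]
  refine ⟨(Submodule.span ℝ
    ((Finset.Iio (⟨i, hi⟩ : Fin _)).image T.rightSingularBasis : Set E))ᗮ, ?_, fun x hx => ?_⟩
  · have := finrank_le_finrank_orthogonal_span_add_card T.rightSingularBasis
      (Finset.Iio (⟨i, hi⟩ : Fin _))
    rwa [Fin.card_Iio] at this
  · rw [norm_sq_apply_eq_sum_singularValues, ← T.rightSingularBasis.sum_sq_inner_right,
      Finset.mul_sum]
    refine Finset.sum_le_sum fun j _ => ?_
    rcases lt_or_ge j ⟨i, hi⟩ with hj | hj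
    · have : ⟪T.rightSingularBasis j, x⟫_ℝ = 0 :=
        (Submodule.mem_orthogonal _ _).1 hx _ (Submodule.subset_span
          (Finset.mem_coe.2 (Finset.mem_image_of_mem _ (Finset.mem_Iio.2 hj))))
      simp [this]
    · exact mul_le_mul_of_nonneg_right (pow_le_pow_left₀ (T.singularValues_nonneg _)
        (T.singularValues_antitone hj) 2) (sq_nonneg _)

theorem _root_.Submodule.exists_mem_inf_ne_zero_of_finrank_lt {U V : Submodule ℝ E}
    (h : finrank ℝ E < finrank ℝ U + finrank ℝ V) : ∃ x, x ∈ U ∧ x ∈ V ∧ x ≠ 0 := by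
  have h1 := Submodule.finrank_sup_add_finrank_inf_eq U V
  have h2 := (U ⊔ V).finrank_le
  have h3 : U ⊓ V ≠ ⊥ := fun h0 => by rw [h0, finrank_bot] at h1; lia
  obtain ⟨x, hx, hx0⟩ := Submodule.exists_mem_ne_zero_of_ne_bot h3
  exact ⟨x, hx.1, hx.2, hx0⟩

/-- One half of the min-max principle: a lower bound on a subspace of dimension `i + 1` bounds the
`i`-th singular value from below. -/
theorem le_singularValues_sq (T : E →ₗ[ℝ] F) {i : ℕ} {c : ℝ} (U : Submodule ℝ E)
    (hU : i + 1 ≤ finrank ℝ U) (h : ∀ x ∈ U, c * ‖x‖ ^ 2 ≤ ‖T x‖ ^ 2) :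
    c ≤ T.singularValues i ^ 2 := by
  obtain ⟨V, hV, hVle⟩ := T.exists_submodule_le_singularValues_sq_mul i
  obtain ⟨x, hxU, hxV, hx⟩ := Submodule.exists_mem_inf_ne_zero_of_finrank_lt
    (U := U) (V := V) (by lia)
  exact le_of_mul_le_mul_right ((h x hxU).trans (hVle x hxV)) (by positivity)

/-- The other half of the min-max principle: an upper bound on a subspace of codimension at most `i`
bounds the `i`-th singular value from above. -/
theorem singularValues_sq_le (T : E →ₗ[ℝ] F) {i : ℕ} {c : ℝ} (hc : 0 ≤ c) (V : Submodule ℝ E)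
    (hV : finrank ℝ E ≤ finrank ℝ V + i) (h : ∀ x ∈ V, ‖T x‖ ^ 2 ≤ c * ‖x‖ ^ 2) :
    T.singularValues i ^ 2 ≤ c := by
  rcases le_or_gt (finrank ℝ E) i with hi | hi
  · simpa [T.singularValues_of_finrank_le hi] using hc
  obtain ⟨U, hU, hUle⟩ := T.exists_submodule_singularValues_sq_mul_le hi
  obtain ⟨x, hxU, hxV, hx⟩ := Submodule.exists_mem_inf_ne_zero_of_finrank_lt
    (U := U) (V := V) (by lia)
  exact le_of_mul_le_mul_right ((hUle x hxU).trans (h x hxV)) (by positivity)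

theorem _root_.Submodule.finrank_le_finrank_comap_add (f : E →ₗ[ℝ] F) {V : Submodule ℝ F} {i : ℕ}
    (hV : finrank ℝ F ≤ finrank ℝ V + i) : finrank ℝ E ≤ finrank ℝ (V.comap f) + i := by
  have h1 := (V.mkQ ∘ₗ f).finrank_range_add_finrank_ker
  rw [ker_comp, Submodule.ker_mkQ] at h1
  have h2 := (range (V.mkQ ∘ₗ f)).finrank_le
  have h3 := V.finrank_quotient_add_finrank
  lia

theorem sum_singularValues_sq_eq_trace (T : E →ₗ[ℝ] F) :
    ∑ i : Fin (finrank ℝ E), T.singularValues i ^ 2 = trace ℝ E (adjoint T ∘ₗ T) := by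
  rw [T.isSymmetric_adjoint_comp_self.trace_eq_sum_eigenvalues rfl]
  exact Finset.sum_congr rfl fun i _ => T.sq_singularValues_fin rfl i

theorem abs_trace_le_sum_singularValues (T : E →ₗ[ℝ] E) :
    |trace ℝ E T| ≤ ∑ i : Fin (finrank ℝ E), T.singularValues i := by
  rw [trace_eq_sum_inner T T.rightSingularBasis]
  refine (Finset.abs_sum_le_sum_abs _ _).trans (Finset.sum_le_sum fun i _ => ?_)
  refine (abs_real_inner_le_norm _ _).trans ?_
  rw [norm_apply_rightSingularBasis, OrthonormalBasis.norm_eq_one, one_mul]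

end SingularValues

end LinearMap

/-! ### Singular values of matrices -/

section Matrices

open Matrix Module InnerProductSpace

theorem matrixSingularValues_nonneg {m n : ℕ} (W : Matrix (Fin m) (Fin n) ℝ) (i : ℕ) :
    0 ≤ matrixSingularValues W i :=
  LinearMap.singularValues_nonneg _ i

theorem matrixSingularValues_support {m n : ℕ} (W : Matrix (Fin m) (Fin n) ℝ) :
    (matrixSingularValues W).support = Finset.range W.rank := by
  rw [matrixSingularValues, LinearMap.support_singularValues,
    Matrix.rank_eq_finrank_range_toLin W (EuclideanSpace.basisFun (Fin m) ℝ).toBasis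
      (EuclideanSpace.basisFun (Fin n) ℝ).toBasis, ← Matrix.toEuclideanLin_eq_toLin_orthonormal]

theorem matrixSingularValues_sum_eq {m n : ℕ} (W : Matrix (Fin m) (Fin n) ℝ) {f : ℝ → ℝ}
    (hf : f 0 = 0) {R : ℕ} (hR : W.rank ≤ R) :
    (matrixSingularValues W).sum (fun _ s => f s)
      = ∑ i ∈ Finset.range R, f (matrixSingularValues W i) := by
  refine Finsupp.sum_of_support_subset _ ?_ _ fun _ _ => hf
  rw [matrixSingularValues_support]
  exact Finset.range_mono hR

theorem nuclearNorm_eq_sum_fin {m n : ℕ} (W : Matrix (Fin m) (Fin n) ℝ) :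
    nuclearNorm W = ∑ i : Fin (finrank ℝ (EuclideanSpace ℝ (Fin n))),
      (toEuclideanLin W).singularValues i := by
  rw [nuclearNorm, matrixSingularValues_sum_eq W (f := fun s => s) rfl (R := n) W.rank_le_width,
    ← Fin.sum_univ_eq_sum_range (fun i => matrixSingularValues W i),
    finrank_euclideanSpace_fin]
  rfl

theorem nuclearNorm_nonneg {m n : ℕ} (W : Matrix (Fin m) (Fin n) ℝ) : 0 ≤ nuclearNorm W :=
  Finset.sum_nonneg fun i _ => matrixSingularValues_nonneg W i

theorem matrixSingularValues_zero_le_nuclearNorm {m n : ℕ} (W : Matrix (Fin m) (Fin n) ℝ) :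
    matrixSingularValues W 0 ≤ nuclearNorm W := by
  by_cases h : 0 ∈ (matrixSingularValues W).support
  · exact Finset.single_le_sum (f := matrixSingularValues W)
      (fun i _ => matrixSingularValues_nonneg W i) h
  · rw [Finsupp.notMem_support_iff.1 h]
    exact nuclearNorm_nonneg W

theorem trace_toEuclideanLin {n : ℕ} (W : Matrix (Fin n) (Fin n) ℝ) :
    LinearMap.trace ℝ _ (toEuclideanLin W) = W.trace := by
  rw [LinearMap.trace_eq_matrix_trace ℝ (EuclideanSpace.basisFun (Fin n) ℝ).toBasis,
    Matrix.toEuclideanLin_eq_toLin_orthonormal, LinearMap.toMatrix_toLin]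

theorem abs_trace_le_nuclearNorm {n : ℕ} (W : Matrix (Fin n) (Fin n) ℝ) :
    |W.trace| ≤ nuclearNorm W := by
  have h := (toEuclideanLin W).abs_trace_le_sum_singularValues
  rwa [← nuclearNorm_eq_sum_fin, trace_toEuclideanLin] at h

theorem frobenius_norm_sq_eq_trace {m n : ℕ} (W : Matrix (Fin m) (Fin n) ℝ) :
    ‖W‖ ^ 2 = (Wᵀ * W).trace := by
  rw [frobenius_norm_def, ← Real.sqrt_eq_rpow, Real.sq_sqrt (by positivity), Matrix.trace,
    Finset.sum_comm]
  simp [Matrix.mul_apply, ← sq]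

theorem adjoint_toEuclideanLin {m n : ℕ} (W : Matrix (Fin m) (Fin n) ℝ) :
    LinearMap.adjoint (toEuclideanLin W) = toEuclideanLin Wᵀ := by
  rw [← Matrix.toEuclideanLin_conjTranspose_eq_adjoint, conjTranspose_eq_transpose_of_trivial]

theorem toEuclideanLin_mul_apply {l m n : ℕ} (V : Matrix (Fin l) (Fin m) ℝ)
    (W : Matrix (Fin m) (Fin n) ℝ) (x : EuclideanSpace ℝ (Fin n)) :
    toEuclideanLin (V * W) x = toEuclideanLin V (toEuclideanLin W x) := by
  simp [toLpLin_apply]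

theorem frobenius_norm_sq_eq_sum_matrixSingularValues {m n : ℕ} (W : Matrix (Fin m) (Fin n) ℝ)
    {R : ℕ} (hR : W.rank ≤ R) :
    ‖W‖ ^ 2 = ∑ i ∈ Finset.range R, matrixSingularValues W i ^ 2 := by
  rw [← matrixSingularValues_sum_eq W (f := fun s => s ^ 2) (by simp) hR,
    matrixSingularValues_sum_eq W (f := fun s => s ^ 2) (by simp) (R := n) W.rank_le_width,
    ← Fin.sum_univ_eq_sum_range (fun i => matrixSingularValues W i ^ 2)]
  have h := (toEuclideanLin W).sum_singularValues_sq_eq_trace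
  have h2 : LinearMap.adjoint (toEuclideanLin W) ∘ₗ toEuclideanLin W
      = toEuclideanLin (Wᵀ * W) := by
    ext1 x
    rw [adjoint_toEuclideanLin, toEuclideanLin_mul_apply, LinearMap.comp_apply]
  rw [h2, trace_toEuclideanLin, finrank_euclideanSpace_fin] at h
  rw [frobenius_norm_sq_eq_trace, ← h]
  rfl

theorem schattenNorm_rpow_eq_sum {m n : ℕ} {p : ℝ} (hp : 0 < p) (W : Matrix (Fin m) (Fin n) ℝ)
    {R : ℕ} (hR : W.rank ≤ R) :
    schattenNorm p W ^ p = ∑ i ∈ Finset.range R, matrixSingularValues W i ^ p := by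
  rw [schattenNorm, matrixSingularValues_sum_eq W (f := fun s => s ^ p)
    (Real.zero_rpow hp.ne') hR, ← Real.rpow_mul, one_div, inv_mul_cancel₀ hp.ne', Real.rpow_one]
  exact Finset.sum_nonneg fun i _ => Real.rpow_nonneg (matrixSingularValues_nonneg W i) p

/-- The quadratic forms of `Vᵀ V` and `W Wᵀ` differ by at most the nuclear norm of their difference,
which dominates the operator norm. -/
theorem norm_transpose_apply_sq_sub_le {l m n : ℕ} (V : Matrix (Fin l) (Fin m) ℝ)
    (W : Matrix (Fin m) (Fin n) ℝ) (z : EuclideanSpace ℝ (Fin m)) :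
    |‖toEuclideanLin V z‖ ^ 2 - ‖toEuclideanLin Wᵀ z‖ ^ 2|
      ≤ nuclearNorm (Vᵀ * V - W * Wᵀ) * ‖z‖ ^ 2 := by
  have h1 : ‖toEuclideanLin V z‖ ^ 2 = ⟪z, toEuclideanLin (Vᵀ * V) z⟫_ℝ := by
    rw [toEuclideanLin_mul_apply, ← adjoint_toEuclideanLin, LinearMap.adjoint_inner_right,
      real_inner_self_eq_norm_sq]
  have h2 : ‖toEuclideanLin Wᵀ z‖ ^ 2 = ⟪z, toEuclideanLin (W * Wᵀ) z⟫_ℝ := by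
    rw [toEuclideanLin_mul_apply, ← LinearMap.adjoint_inner_left, adjoint_toEuclideanLin,
      real_inner_self_eq_norm_sq]
  rw [h1, h2, ← inner_sub_right, ← LinearMap.sub_apply, ← map_sub]
  refine (abs_real_inner_le_norm _ _).trans ?_
  rw [sq, ← mul_assoc, mul_comm]
  refine mul_le_mul_of_nonneg_right ?_ (norm_nonneg _)
  refine (LinearMap.norm_apply_le_singularValues_zero_mul _ z).trans ?_
  exact mul_le_mul_of_nonneg_right (matrixSingularValues_zero_le_nuclearNorm _) (norm_nonneg _)

/-- The Cauchy–Schwarz inequality for `‖W y‖² = ⟪y, Wᵀ W y⟫`. -/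
theorem norm_apply_pow_four_le {m n : ℕ} (W : Matrix (Fin m) (Fin n) ℝ)
    (y : EuclideanSpace ℝ (Fin n)) :
    (‖toEuclideanLin W y‖ ^ 2) ^ 2
      ≤ ‖y‖ ^ 2 * ‖toEuclideanLin Wᵀ (toEuclideanLin W y)‖ ^ 2 := by
  rw [← mul_pow]
  refine pow_le_pow_left₀ (sq_nonneg _) ?_ 2
  rw [← real_inner_self_eq_norm_sq, ← LinearMap.adjoint_inner_right, adjoint_toEuclideanLin]
  exact real_inner_le_norm _ _

end Matrices

/-! ### Growth ratios along a balanced chain -/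

section Chains

open Matrix Module

/-- Along two consecutive balanced factors, the ratio `‖V z‖² / ‖z‖²` at `z = W y` is at least
`‖W y‖² / ‖y‖² - ε`. -/
theorem sub_mul_norm_sq_le_of_balanced {l m n : ℕ} {V : Matrix (Fin l) (Fin m) ℝ}
    {W : Matrix (Fin m) (Fin n) ℝ} {ε c : ℝ} (hVW : nuclearNorm (Vᵀ * V - W * Wᵀ) ≤ ε)
    {y : EuclideanSpace ℝ (Fin n)} (hy : c * ‖y‖ ^ 2 ≤ ‖toEuclideanLin W y‖ ^ 2) :
    (c - ε) * ‖toEuclideanLin W y‖ ^ 2 ≤ ‖toEuclideanLin V (toEuclideanLin W y)‖ ^ 2 := by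
  have h1 := norm_transpose_apply_sq_sub_le V W (toEuclideanLin W y)
  have h2 := norm_apply_pow_four_le W y
  have h3 := mul_le_mul_of_nonneg_right hVW (sq_nonneg ‖toEuclideanLin W y‖)
  have h4 : c * ‖toEuclideanLin W y‖ ^ 2 ≤ ‖toEuclideanLin Wᵀ (toEuclideanLin W y)‖ ^ 2 := by
    rcases eq_or_ne y 0 with rfl | hy0
    · simp
    refine le_of_mul_le_mul_left (le_trans ?_ h2) (by positivity : 0 < ‖y‖ ^ 2)
    nlinarith [sq_nonneg ‖toEuclideanLin W y‖]
  linarith [(abs_le.1 h1).1]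

/-- Along two consecutive balanced factors, the ratio `‖W y‖² / ‖y‖²` is at most
`‖V z‖² / ‖z‖² + ε` at `z = W y`. -/
theorem norm_sq_le_add_mul_of_balanced {l m n : ℕ} {V : Matrix (Fin l) (Fin m) ℝ}
    {W : Matrix (Fin m) (Fin n) ℝ} {ε c : ℝ} (hVW : nuclearNorm (Vᵀ * V - W * Wᵀ) ≤ ε)
    (hc : 0 ≤ c + ε) {y : EuclideanSpace ℝ (Fin n)}
    (hy : ‖toEuclideanLin V (toEuclideanLin W y)‖ ^ 2 ≤ c * ‖toEuclideanLin W y‖ ^ 2) :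
    ‖toEuclideanLin W y‖ ^ 2 ≤ (c + ε) * ‖y‖ ^ 2 := by
  rcases eq_or_ne (toEuclideanLin W y) 0 with h0 | h0
  · rw [h0, norm_zero, zero_pow two_ne_zero]
    exact mul_nonneg hc (sq_nonneg _)
  have h1 := norm_transpose_apply_sq_sub_le V W (toEuclideanLin W y)
  have h2 := norm_apply_pow_four_le W y
  have h3 := mul_le_mul_of_nonneg_right hVW (sq_nonneg ‖toEuclideanLin W y‖)
  have h4 : ‖toEuclideanLin Wᵀ (toEuclideanLin W y)‖ ^ 2
      ≤ (c + ε) * ‖toEuclideanLin W y‖ ^ 2 := by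
    linarith [(abs_le.1 h1).1]
  refine le_of_mul_le_mul_left ?_ (by positivity : 0 < ‖toEuclideanLin W y‖ ^ 2)
  nlinarith [mul_le_mul_of_nonneg_left h4 (sq_nonneg ‖y‖)]

theorem MatrixChain.partialProd_succ_apply {d : ℕ → ℕ} {L : ℕ} (A : MatrixChain d L) {m : ℕ}
    (h : m + 1 ≤ L) (y : EuclideanSpace ℝ (Fin (d (m + 1)))) :
    toEuclideanLin (A.partialProd (m + 1) h) y
      = toEuclideanLin (A.partialProd m (Nat.le_of_succ_le h)) (toEuclideanLin (A ⟨m, h⟩) y) :=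
  toEuclideanLin_mul_apply _ _ _

theorem MatrixChain.partialProd_one {d : ℕ → ℕ} {L : ℕ} (A : MatrixChain d L) (h : 1 ≤ L) :
    A.partialProd 1 h = A ⟨0, h⟩ :=
  Matrix.one_mul _

/-- If the last factor stretches `y` by at least `c` (in squared norm), the factors to the left of
it stretch by at least `c - ε`, `c - 2 ε`, and so on. -/
theorem MatrixChain.IsBalanced.pow_mul_norm_sq_le {d : ℕ → ℕ} {L : ℕ} {A : MatrixChain d L} {ε : ℝ}
    (hA : A.IsBalanced ε) (hε : 0 ≤ ε) : ∀ (m : ℕ) (h : m + 1 ≤ L) (c : ℝ) (_ : m * ε ≤ c)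
    (y : EuclideanSpace ℝ (Fin (d (m + 1)))) (_ : c * ‖y‖ ^ 2 ≤ ‖toEuclideanLin (A ⟨m, h⟩) y‖ ^ 2),
    (c - m * ε) ^ (m + 1) * ‖y‖ ^ 2 ≤ ‖toEuclideanLin (A.partialProd (m + 1) h) y‖ ^ 2
  | 0, h, c, _, y, hy => by
    rw [A.partialProd_one h]
    simpa using hy
  | m + 1, h, c, hc, y, hy => by
    rw [A.partialProd_succ_apply]
    push_cast at hc ⊢
    have h1 := sub_mul_norm_sq_le_of_balanced (hA m h) hy
    refine le_trans ?_ (hA.pow_mul_norm_sq_le hε m _ (c - ε) (by linarith) _ h1)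
    have h2 : c - (m + 1) * ε = c - ε - m * ε := by ring
    have h3 : 0 ≤ c - ε - m * ε := by linarith
    rw [h2, pow_succ _ (m + 1), mul_assoc]
    refine mul_le_mul_of_nonneg_left (le_trans ?_ hy) (pow_nonneg h3 _)
    have : 0 ≤ m * ε := by positivity
    exact mul_le_mul_of_nonneg_right (by linarith) (sq_nonneg _)

/-- The product of the factors of a chain with indices `1, …, m`, as a linear map. -/
noncomputable def MatrixChain.tail {d : ℕ → ℕ} {L : ℕ} (A : MatrixChain d L) :
    (m : ℕ) → m + 1 ≤ L → EuclideanSpace ℝ (Fin (d (m + 1))) →ₗ[ℝ] EuclideanSpace ℝ (Fin (d 1))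
  | 0, _ => LinearMap.id
  | m + 1, h => A.tail m (Nat.le_of_succ_le h) ∘ₗ toEuclideanLin (A ⟨m + 1, h⟩)

/-- If the first factor stretches by at most `c` (in squared norm) the vector that it receives, the
factors to the right of it have stretched by at most `c + ε`, `c + 2 ε`, and so on. -/
theorem MatrixChain.IsBalanced.norm_sq_le_pow_mul {d : ℕ → ℕ} {L : ℕ} {A : MatrixChain d L} {ε c : ℝ}
    (hA : A.IsBalanced ε) (hε : 0 ≤ ε) (hc : 0 ≤ c) (hL : 1 ≤ L) : ∀ (m : ℕ) (h : m + 1 ≤ L)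
    (y : EuclideanSpace ℝ (Fin (d (m + 1))))
    (_ : ‖toEuclideanLin (A ⟨0, hL⟩) (A.tail m h y)‖ ^ 2 ≤ c * ‖A.tail m h y‖ ^ 2),
    ‖toEuclideanLin (A ⟨m, h⟩) y‖ ^ 2 ≤ (c + m * ε) * ‖y‖ ^ 2 ∧
    ‖toEuclideanLin (A.partialProd (m + 1) h) y‖ ^ 2 ≤ (c + m * ε) ^ (m + 1) * ‖y‖ ^ 2
  | 0, h, y, hy => by
    rw [A.partialProd_one h]
    have : ‖toEuclideanLin (A ⟨0, hL⟩) y‖ ^ 2 ≤ c * ‖y‖ ^ 2 := hy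
    simpa using this
  | m + 1, h, y, hy => by
    obtain ⟨h1, h2⟩ := hA.norm_sq_le_pow_mul hε hc hL m (Nat.le_of_succ_le h) _ hy
    have h0 : 0 ≤ c + m * ε := by positivity
    have h3 : c + m * ε + ε = c + ((m + 1 : ℕ) : ℝ) * ε := by push_cast; ring
    have h4 := norm_sq_le_add_mul_of_balanced (hA m h) (by positivity) h1
    rw [h3] at h4
    refine ⟨h4, ?_⟩
    rw [A.partialProd_succ_apply, pow_succ _ (m + 1), mul_assoc]
    refine h2.trans (mul_le_mul (pow_le_pow_left₀ h0 (by linarith) _) h4 (sq_nonneg _) ?_)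
    exact pow_nonneg (by linarith) _

/-! ### Singular values of the product of a balanced chain -/

variable {d : ℕ → ℕ} {M : ℕ} {A : MatrixChain d (M + 1)} {ε : ℝ}

theorem MatrixChain.IsBalanced.sub_pow_le_singularValues_prod_sq (hA : A.IsBalanced ε) (hε : 0 ≤ ε)
    {i : ℕ} (hi : M * ε ≤ matrixSingularValues (A (Fin.last M)) i ^ 2) :
    (matrixSingularValues (A (Fin.last M)) i ^ 2 - M * ε) ^ (M + 1)
      ≤ matrixSingularValues A.prod i ^ 2 := by
  rcases lt_or_ge i (finrank ℝ (EuclideanSpace ℝ (Fin (d (M + 1))))) with h | h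
  · obtain ⟨U, hU, hUle⟩ :=
      (toEuclideanLin (A (Fin.last M))).exists_submodule_singularValues_sq_mul_le h
    exact LinearMap.le_singularValues_sq _ U hU fun x hx =>
      hA.pow_mul_norm_sq_le hε M le_rfl _ hi x (hUle x hx)
  · have h0 : matrixSingularValues (A (Fin.last M)) i = 0 :=
      LinearMap.singularValues_of_finrank_le _ h
    have h1 : (0 : ℝ) ^ 2 - M * ε = 0 := by
      rw [h0] at hi
      have : 0 ≤ M * ε := by positivity
      linarith
    rw [h0, h1, zero_pow M.succ_ne_zero]
    positivity

theorem MatrixChain.IsBalanced.singularValues_prod_sq_le_add_pow (hA : A.IsBalanced ε)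
    (hε : 0 ≤ ε) (i : ℕ) :
    matrixSingularValues A.prod i ^ 2
      ≤ (matrixSingularValues (A 0) i ^ 2 + M * ε) ^ (M + 1) := by
  obtain ⟨V, hV, hVle⟩ := (toEuclideanLin (A 0)).exists_submodule_le_singularValues_sq_mul i
  refine LinearMap.singularValues_sq_le _ (by positivity) (V.comap (A.tail M le_rfl))
    (Submodule.finrank_le_finrank_comap_add _ hV) fun x hx => ?_
  exact (hA.norm_sq_le_pow_mul hε (sq_nonneg _) (Nat.le_add_left 1 M) M le_rfl x (hVle _ hx)).2

theorem Real.rpow_two_div_eq (s : ℝ) (hs : 0 ≤ s) (n : ℕ) :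
    s ^ (2 / (n : ℝ)) = (s ^ 2) ^ ((n : ℝ)⁻¹) := by
  rw [div_eq_mul_inv, Real.rpow_mul hs, Real.rpow_two]

theorem MatrixChain.IsBalanced.sub_le_singularValues_prod_rpow (hA : A.IsBalanced ε) (hε : 0 ≤ ε)
    (i : ℕ) : matrixSingularValues (A (Fin.last M)) i ^ 2 - M * ε
      ≤ matrixSingularValues A.prod i ^ (2 / ((M + 1 : ℕ) : ℝ)) := by
  have hs := matrixSingularValues_nonneg A.prod i
  rcases le_or_gt (M * ε) (matrixSingularValues (A (Fin.last M)) i ^ 2) with h | h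
  · rw [Real.rpow_two_div_eq _ hs]
    have h1 := Real.rpow_le_rpow (pow_nonneg (sub_nonneg.2 h) _)
      (hA.sub_pow_le_singularValues_prod_sq hε h) (inv_nonneg.2 (Nat.cast_nonneg (M + 1)))
    rwa [Real.pow_rpow_inv_natCast (sub_nonneg.2 h) M.succ_ne_zero] at h1
  · exact (sub_neg.2 h).le.trans (Real.rpow_nonneg hs _)

theorem MatrixChain.IsBalanced.singularValues_prod_rpow_le_add (hA : A.IsBalanced ε) (hε : 0 ≤ ε)
    (i : ℕ) : matrixSingularValues A.prod i ^ (2 / ((M + 1 : ℕ) : ℝ))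
      ≤ matrixSingularValues (A 0) i ^ 2 + M * ε := by
  have hs := matrixSingularValues_nonneg A.prod i
  rw [Real.rpow_two_div_eq _ hs]
  have h1 := Real.rpow_le_rpow (sq_nonneg _)
    (hA.singularValues_prod_sq_le_add_pow hε i) (inv_nonneg.2 (Nat.cast_nonneg (M + 1)))
  rwa [Real.pow_rpow_inv_natCast (by positivity) M.succ_ne_zero] at h1

/-! ### The Schatten norm of the product -/

theorem abs_frobenius_norm_sq_sub_le {l m n : ℕ} (V : Matrix (Fin l) (Fin m) ℝ)
    (W : Matrix (Fin m) (Fin n) ℝ) :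
    |‖V‖ ^ 2 - ‖W‖ ^ 2| ≤ nuclearNorm (Vᵀ * V - W * Wᵀ) := by
  refine le_trans (le_of_eq ?_) (abs_trace_le_nuclearNorm _)
  rw [Matrix.trace_sub, Matrix.trace_mul_comm W, frobenius_norm_sq_eq_trace,
    frobenius_norm_sq_eq_trace]

theorem MatrixChain.IsBalanced.abs_norm_sq_sub_le (hA : A.IsBalanced ε) (j k : Fin (M + 1)) :
    |‖A j‖ ^ 2 - ‖A k‖ ^ 2| ≤ |(j : ℝ) - k| * ε := by
  wlog hjk : j ≤ k generalizing j k
  · rw [abs_sub_comm, abs_sub_comm (j : ℝ)]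
    exact this k j (le_of_not_ge hjk)
  have key : ∀ (n : ℕ) (h : j + n < M + 1), |‖A j‖ ^ 2 - ‖A ⟨j + n, h⟩‖ ^ 2| ≤ n * ε := by
    intro n
    induction n with
    | zero => intro h; simp
    | succ n ih =>
      intro h
      have h1 := (abs_frobenius_norm_sq_sub_le _ _).trans (hA (j + n) h)
      refine (abs_sub_le _ _ _).trans ((add_le_add (ih (by lia)) h1).trans (le_of_eq ?_))
      push_cast
      ring
  have h1 : (j : ℕ) ≤ k := hjk
  have h2 := key (k - j) (by lia)
  have h3 : (⟨j + (k - j), by lia⟩ : Fin (M + 1)) = k := Fin.ext (by simp; lia)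
  rw [h3, Nat.cast_sub h1] at h2
  rwa [abs_sub_comm (j : ℝ), abs_of_nonneg (sub_nonneg.2 (Nat.cast_le.2 h1))]

theorem MatrixChain.IsBalanced.abs_schattenNorm_prod_sub_le (hA : A.IsBalanced ε) (hε : 0 ≤ ε)
    {R : ℕ} (h0 : (A 0).rank ≤ R) (hM : (A (Fin.last M)).rank ≤ R) (k : Fin (M + 1)) :
    |schattenNorm (2 / ((M + 1 : ℕ) : ℝ)) A.prod ^ (2 / ((M + 1 : ℕ) : ℝ)) - ‖A k‖ ^ 2|
      ≤ (R + 1) * (M * ε) := by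
  have hp : 0 < 2 / ((M + 1 : ℕ) : ℝ) := by positivity
  have hprod : A.prod.rank ≤ R := (Matrix.rank_mul_le_right _ _).trans hM
  have hf0 := frobenius_norm_sq_eq_sum_matrixSingularValues (A 0) h0
  have hfM := frobenius_norm_sq_eq_sum_matrixSingularValues (A (Fin.last M)) hM
  have hlow := Finset.sum_le_sum fun i (_ : i ∈ Finset.range R) =>
    hA.sub_le_singularValues_prod_rpow hε i
  have hup := Finset.sum_le_sum fun i (_ : i ∈ Finset.range R) =>
    hA.singularValues_prod_rpow_le_add hε i
  rw [← schattenNorm_rpow_eq_sum hp _ hprod, Finset.sum_sub_distrib, ← hfM, Finset.sum_const,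
    Finset.card_range, nsmul_eq_mul] at hlow
  rw [← schattenNorm_rpow_eq_sum hp _ hprod, Finset.sum_add_distrib, ← hf0, Finset.sum_const,
    Finset.card_range, nsmul_eq_mul] at hup
  have hk : ∀ j : Fin (M + 1), |‖A j‖ ^ 2 - ‖A k‖ ^ 2| ≤ M * ε := fun j => by
    refine (hA.abs_norm_sq_sub_le j k).trans (mul_le_mul_of_nonneg_right ?_ hε)
    have h1 : (j : ℝ) ≤ M := Nat.cast_le.2 (Nat.lt_succ_iff.1 j.2)
    have h2 : (k : ℝ) ≤ M := Nat.cast_le.2 (Nat.lt_succ_iff.1 k.2)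
    have h3 : (0 : ℝ) ≤ (j : ℕ) := Nat.cast_nonneg _
    have h4 : (0 : ℝ) ≤ (k : ℕ) := Nat.cast_nonneg _
    exact abs_le.2 ⟨by linarith, by linarith⟩
  have hk0 := abs_le.1 (hk 0)
  have hkM := abs_le.1 (hk (Fin.last M))
  exact abs_le.2 ⟨by linarith [hkM.1], by linarith [hk0.2]⟩

end Chains

/-! ### The smallness condition -/

/-- The smallness condition turns a bound linear in `ε` into one of order `ε ^ (1 / n)`. -/
theorem mul_pow_four_le_of_le_one_div_mul_pow {ε s : ℝ} {M : ℕ} (hε : 0 < ε) (hs : 0 ≤ s)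
    (h : ε ≤ 1 / ((M + 1 : ℕ) : ℝ) ^ 4 * s ^ (M + 1)) :
    ε * ((M + 1 : ℕ) : ℝ) ^ 4
      ≤ s ^ M * ((M + 1 : ℕ) : ℝ) ^ (4 / ((M + 1 : ℕ) : ℝ)) * ε ^ (1 / ((M + 1 : ℕ) : ℝ)) := by
  have hn : (0 : ℝ) < ((M + 1 : ℕ) : ℝ) := by positivity
  set n : ℝ := ((M + 1 : ℕ) : ℝ) with hndef
  set t := ε ^ (1 / n)
  set u := n ^ (4 / n)
  have ht0 : 0 ≤ t := by positivity
  have hu0 : 0 ≤ u := by positivity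
  have ht : t ^ (M + 1) = ε := by
    rw [← Real.rpow_natCast, ← Real.rpow_mul hε.le, ← hndef, one_div, inv_mul_cancel₀ hn.ne',
      Real.rpow_one]
  have hu : u ^ (M + 1) = n ^ 4 := by
    rw [← Real.rpow_natCast, ← Real.rpow_mul hn.le, ← hndef, div_mul_cancel₀ _ hn.ne']
    exact_mod_cast Real.rpow_natCast n 4
  have htu : (u * t) ^ (M + 1) ≤ s ^ (M + 1) := by
    rw [mul_pow, ht, hu]
    have h1 := mul_le_mul_of_nonneg_left h (by positivity : 0 ≤ n ^ 4)
    rwa [← mul_assoc, mul_one_div_cancel (by positivity), one_mul] at h1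
  have htus : u * t ≤ s := le_of_pow_le_pow_left₀ M.succ_ne_zero hs htu
  calc ε * n ^ 4 = (u * t) ^ M * (u * t) := by rw [← ht, ← hu, ← mul_pow, pow_succ, mul_comm t u]
    _ ≤ s ^ M * (u * t) := mul_le_mul_of_nonneg_right
        (pow_le_pow_left₀ (by positivity) htus _) (by positivity)
    _ = s ^ M * u * t := by ring

theorem mainTheorem7 (L q r : ℕ) (hL : 1 ≤ L) (hr : 0 < r) (hqr : r ≤ q)
    (A : MatrixChain (chainDim q r L) L) (ε : ℝ) (hε : 0 < ε)
    (hbal : A.IsBalanced ε)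
    (hsmall : ε ≤ 1 / (L : ℝ) ^ 4 * ⨅ l : Fin L, nuclearNorm (A l) ^ L) :
    (∀ k : Fin L,
      |schattenNorm (2 / (L : ℝ)) A.prod ^ (2 / (L : ℝ)) - ‖A k‖ ^ 2|
        ≤ (r : ℝ) * nuclearNorm (A k) ^ (L - 1) * Real.exp (2 / (L : ℝ))
          * (L : ℝ) ^ (4 / (L : ℝ)) * ε ^ (1 / (L : ℝ))) ∧
    |schattenNorm (2 / (L : ℝ)) A.prod ^ (2 / (L : ℝ))
        - 1 / (L : ℝ) * ∑ l : Fin L, ‖A l‖ ^ 2|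
      ≤ (r : ℝ) / (L : ℝ) * (∑ l : Fin L, nuclearNorm (A l) ^ (L - 1))
        * Real.exp (2 / (L : ℝ)) * (L : ℝ) ^ (4 / (L : ℝ)) * ε ^ (1 / (L : ℝ)) := by
  obtain ⟨M, rfl⟩ : ∃ M, L = M + 1 := ⟨L - 1, by lia⟩
  rw [Nat.add_sub_cancel]
  have hn : (0 : ℝ) < ((M + 1 : ℕ) : ℝ) := by positivity
  have hr1 : (1 : ℝ) ≤ r := Nat.one_le_cast.2 hr
  -- For a single factor the linear bound vanishes; otherwise both end factors have rank at most `r`.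
  have hlin : ∀ k, |schattenNorm (2 / ((M + 1 : ℕ) : ℝ)) A.prod ^ (2 / ((M + 1 : ℕ) : ℝ))
      - ‖A k‖ ^ 2| ≤ 2 * r * (M * ε) := fun k => by
    rcases Nat.eq_zero_or_pos M with rfl | hM
    · refine (hbal.abs_schattenNorm_prod_sub_le hε.le le_rfl le_rfl k).trans (le_of_eq ?_)
      simp
    · have h0 : (A 0).rank ≤ r := by
        have hd : chainDim q r (M + 1) (0 + 1) = r := if_neg (by lia)
        exact ((A 0).rank_le_width).trans_eq hd
      have h1 : (A (Fin.last M)).rank ≤ r := by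
        have hd : chainDim q r (M + 1) M = r := if_neg (by lia)
        exact ((A (Fin.last M)).rank_le_height).trans_eq hd
      refine (hbal.abs_schattenNorm_prod_sub_le hε.le h0 h1 k).trans ?_
      exact mul_le_mul_of_nonneg_right (by linarith) (by positivity)
  have hM4 : 2 * (M : ℝ) ≤ ((M + 1 : ℕ) : ℝ) ^ 4 := by
    have h1 : ((M + 1 : ℕ) : ℝ) ^ 2 ≤ ((M + 1 : ℕ) : ℝ) ^ 4 :=
      pow_le_pow_right₀ (Nat.one_le_cast.2 hL) (by norm_num)
    refine le_trans ?_ h1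
    push_cast
    nlinarith [sq_nonneg (M : ℝ)]
  have hk : ∀ k : Fin (M + 1),
      |schattenNorm (2 / ((M + 1 : ℕ) : ℝ)) A.prod ^ (2 / ((M + 1 : ℕ) : ℝ)) - ‖A k‖ ^ 2|
        ≤ (r : ℝ) * nuclearNorm (A k) ^ M * Real.exp (2 / ((M + 1 : ℕ) : ℝ))
          * ((M + 1 : ℕ) : ℝ) ^ (4 / ((M + 1 : ℕ) : ℝ)) * ε ^ (1 / ((M + 1 : ℕ) : ℝ)) := fun k => by
    have hs := nuclearNorm_nonneg (A k)
    have hεk : ε ≤ 1 / ((M + 1 : ℕ) : ℝ) ^ 4 * nuclearNorm (A k) ^ (M + 1) :=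
      hsmall.trans (mul_le_mul_of_nonneg_left (ciInf_le (Set.finite_range _).bddBelow k)
        (by positivity))
    have h1 := mul_pow_four_le_of_le_one_div_mul_pow hε hs hεk
    have h2 : (1 : ℝ) ≤ Real.exp (2 / ((M + 1 : ℕ) : ℝ)) := Real.one_le_exp (by positivity)
    calc _ ≤ 2 * r * (M * ε) := hlin k
      _ = r * (ε * (2 * M)) := by ring
      _ ≤ r * (ε * ((M + 1 : ℕ) : ℝ) ^ 4) := by gcongr
      _ ≤ r * (nuclearNorm (A k) ^ M * ((M + 1 : ℕ) : ℝ) ^ (4 / ((M + 1 : ℕ) : ℝ))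
            * ε ^ (1 / ((M + 1 : ℕ) : ℝ))) := by gcongr
      _ ≤ r * (nuclearNorm (A k) ^ M * ((M + 1 : ℕ) : ℝ) ^ (4 / ((M + 1 : ℕ) : ℝ))
            * ε ^ (1 / ((M + 1 : ℕ) : ℝ))) * Real.exp (2 / ((M + 1 : ℕ) : ℝ)) :=
          le_mul_of_one_le_right (by positivity) h2
      _ = _ := by ring
  refine ⟨hk, ?_⟩
  set S := schattenNorm (2 / ((M + 1 : ℕ) : ℝ)) A.prod ^ (2 / ((M + 1 : ℕ) : ℝ))
  -- The second estimate is the average of the first one over the factors.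
  have hS : S - 1 / ((M + 1 : ℕ) : ℝ) * ∑ l, ‖A l‖ ^ 2
      = 1 / ((M + 1 : ℕ) : ℝ) * ∑ l, (S - ‖A l‖ ^ 2) := by
    rw [Finset.sum_sub_distrib, Finset.sum_const, Finset.card_univ, Fintype.card_fin, nsmul_eq_mul]
    field_simp
  rw [hS, abs_mul, abs_of_pos (one_div_pos.2 hn)]
  calc _ ≤ 1 / ((M + 1 : ℕ) : ℝ) * ∑ l, |S - ‖A l‖ ^ 2| :=
        mul_le_mul_of_nonneg_left (Finset.abs_sum_le_sum_abs _ _) (by positivity)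
    _ ≤ _ := mul_le_mul_of_nonneg_left (Finset.sum_le_sum fun l _ => hk l) (by positivity)
    _ = _ := by
      simp only [← Finset.sum_mul, ← Finset.mul_sum]
      ring
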